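/- Let $K$ be a field, let $S=K[x_1,\ldots,x_m,y_1,\ldots,y_n]$ be the standard bigraded polynomial ring with $\deg x_i=(1,0)$ and $\deg y_j=(0,1)$, let $Q=(y_1,\ldots,y_n)$, and let $M$ be a finitely generated bigraded (that is, $\mathbb{Z}^2$-graded) $S$-module. For an $S$-module $N$, let $\operatorname{cd}(Q,N)$ be the cohomological dimension of $N$ with respect to $Q$, that is, the largest integer $k$ for which the local cohomology module $H^k_Q(N)$ is nonzero, or more generally the supremum of these $k$ (with $\operatorname{cd}(Q,N)=-\infty$ if all $H^k_Q(N)$ vanish, for instance if $N=0$). Let $$0=D_0\subsetneq D_1\subsetneq\cdots\subsetneq D_r=M$$ be the dimension filtration of $M$ with respect to $Q$, that is, a chain of bigraded submodules of $M$ such that, for each $i=1,\ldots,r$, $D_{i-1}$ is the largest bigraded submodule $N$ of $D_i$ with $\operatorname{cd}(Q,N)<\operatorname{cd}(Q,D_i)$. For $i=1,\ldots,r$ set $$B_i=\{\mathfrak p\in\operatorname{Ass}(M) : \operatorname{cd}(Q,S/\mathfrak p)\le\operatorname{cd}(Q,D_i)\}.$$ Then for every $i=1,\ldots,r$: (a)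 $\operatorname{Ass}(D_i)=B_i$; (b) $\operatorname{Ass}(M/D_i)=\operatorname{Ass}(M)\setminus B_i$. -/

import Mathlib

universe u

/-- The cohomological dimension of the module `M` with respect to the ideal `I`: the supremum of
all `k` for which the local cohomology module `H^k_I(M)` is nonzero. It is the largest such `k`
whenever there is one and these `k` are bounded, and it is `⊥` (that is, `-∞`) when all the
local cohomology modules vanish, for example for `M = 0`. -/
noncomputable def cohomDim {R : Type u} [CommRing R] (I : Ideal R)
    (M : Type u) [AddCommGroup M] [Module R M] : WithBot ℕ∞ :=
  ⨆ k ∈ {k : ℕ | ¬ CategoryTheory.Limits.IsZero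
    ((localCohomology I k).obj (ModuleCat.of R M))}, ((k : ℕ∞) : WithBot ℕ∞)

/-- The polynomial ring `K[x_1, …, x_m, y_1, …, y_n]`. The variable `x_i` is `X (Sum.inl i)` and
the variable `y_j` is `X (Sum.inr j)`. -/
abbrev BiPoly (K : Type u) [Field K] (m n : ℕ) : Type u :=
  MvPolynomial (Fin m ⊕ Fin n) K

/-- The bidegrees of the variables: `deg x_i = (1, 0)` and `deg y_j = (0, 1)`. -/
def bidegree (m n : ℕ) : Fin m ⊕ Fin n → ℤ × ℤ :=
  Sum.elim (fun _ => (1, 0)) (fun _ => (0, 1))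

/-- The standard bigrading of `K[x_1, …, x_m, y_1, …, y_n]`, indexed by `ℤ × ℤ` (the components
outside `ℕ × ℕ` are zero). -/
noncomputable abbrev bigrading (K : Type u) [Field K] (m n : ℕ) :
    ℤ × ℤ → Submodule K (BiPoly K m n) :=
  MvPolynomial.weightedHomogeneousSubmodule K (bidegree m n)

/-- The ideal `Q = (y_1, …, y_n)`. -/
noncomputable def idealQ (K : Type u) [Field K] (m n : ℕ) : Ideal (BiPoly K m n) :=
  Ideal.span (Set.range fun j : Fin n => MvPolynomial.X (Sum.inr j))

/-- `0 = D_0 ⊊ D_1 ⊊ ⋯ ⊊ D_r = M` is the dimension filtration of the bigraded module `M`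
with respect to `Q`: a strictly increasing chain of bigraded submodules such that, for
`i = 1, …, r`, the module `D_{i-1}` is the largest bigraded submodule `N` of `D_i` with
`cd(Q, N) < cd(Q, D_i)`. -/
structure IsDimensionFiltration {K : Type u} [Field K] {m n : ℕ}
    {M : Type u} [AddCommGroup M] [Module (BiPoly K m n) M]
    (ℳ : ℤ × ℤ → AddSubgroup M) [DirectSum.Decomposition ℳ]
    {r : ℕ} (D : Fin (r + 1) → Submodule (BiPoly K m n) M) : Prop where
  zero_eq_bot : D 0 = ⊥
  last_eq_top : D (Fin.last r) = ⊤
  strictMono : StrictMono D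
  isHomogeneous : ∀ i, (D i).IsHomogeneous ℳ
  isGreatest : ∀ i : Fin r, IsGreatest
    {N : Submodule (BiPoly K m n) M | N.IsHomogeneous ℳ ∧ N ≤ D i.succ ∧
      cohomDim (idealQ K m n) N < cohomDim (idealQ K m n) (D i.succ)}
    (D i.castSucc)

/-- For a submodule `N` of `M`, the set of all `p ∈ Ass(M)` with `cd(Q, S/p) ≤ cd(Q, N)`.
For `N = D_i` this is the set `B_i`. -/
def primesUpTo {K : Type u} [Field K] {m n : ℕ}
    {M : Type u} [AddCommGroup M] [Module (BiPoly K m n) M]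
    (N : Submodule (BiPoly K m n) M) : Set (Ideal (BiPoly K m n)) :=
  {p | p ∈ associatedPrimes (BiPoly K m n) M ∧
    cohomDim (idealQ K m n) (BiPoly K m n ⧸ p) ≤ cohomDim (idealQ K m n) N}

/-! The key fact is that cd(Q, -) is controlled by the support: if a prime `p` contains Ann(L), then
cd(Q, S/p) ≤ cd(Q, L) (`cohomDim_quotient_le`), while cd(Q, N) is bounded by any common bound for
the cd(Q, S/q), `q` prime over Ann(N) (`cohomDim_le_of_forall_prime`). Hence N + D_j has
cohomological dimension at most the larger of those of N and D_j, and maximality, applied down the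
chain, puts into D_i every bigraded N with cd(Q, N) ≤ cd(Q, D_i).

Associated primes of M and M/D_i have the form (0 : z) and (D_i : z) with z bihomogeneous
(`exists_colon_eq_of_isPrime`). If pz ⊆ D_i and cd(Q, S/p) ≤ cd(Q, D_i), then D_i + Sz is such an N,
so z ∈ D_i. For p = (0 : z) this gives (a). For p = (D_i : z) ≠ S it forces cd(Q, S/p) > cd(Q, D_i),
so Ann(D_i) ⊄ p, and any s in Ann(D_i) outside p gives p = (0 : sz), hence (b).

The support statement rests on exactness properties of local cohomology and on its vanishing above
degree n. Both come from `isZero_iff`, a vanishing criterion in terms of `Abelian.Ext`. -/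

open CategoryTheory Limits

/-! ### Cohomology classes and cocycles in the opposite category -/

namespace ChainComplex

variable {R : Type u} [Ring R]

/-- The element `ξ` of the cohomology of the cochain complex of modules opposite to `K` is the
class of `f`. -/
def IsClassOf (K : ChainComplex (ModuleCat.{u} R)ᵒᵖ ℕ) (n : ℕ)
    (f : (K.X n).unop) (ξ : (K.homology n).unop) : Prop :=
  ∃ z : (K.opcycles n).unop, (K.pOpcycles n).unop z = f ∧ (K.homologyι n).unop z = ξ

variable (K : ChainComplex (ModuleCat.{u} R)ᵒᵖ ℕ) (n : ℕ)

/-- Passing to the opposite turns opcycles into cocycles, and `homologyι` into the projection from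
cocycles to cohomology. -/
lemma exact_unop_pOpcycles :
    Function.Exact (K.pOpcycles n).unop.hom (K.d (n + 1) n).unop.hom := by
  have h : (ShortComplex.mk (K.d (n + 1) n) (K.pOpcycles n) (by simp)).Exact :=
    ShortComplex.exact_of_g_is_cokernel _ (K.opcyclesIsCokernel (n + 1) n (by simp))
  exact (ShortComplex.ShortExact.moduleCat_exact_iff_function_exact _).1 h.unop

lemma unop_pOpcycles_injective : Function.Injective (K.pOpcycles n).unop.hom :=
  (ModuleCat.mono_iff_injective _).1 inferInstance

lemma exact_unop_fromOpcycles :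
    Function.Exact (K.fromOpcycles n ((ComplexShape.down ℕ).next n)).unop.hom
      (K.homologyι n).unop.hom := by
  have h : (ShortComplex.mk (K.homologyι n) (K.fromOpcycles n ((ComplexShape.down ℕ).next n))
      (by simp)).Exact :=
    ShortComplex.exact_of_f_is_kernel _ (K.homologyIsKernel n _ rfl)
  exact (ShortComplex.ShortExact.moduleCat_exact_iff_function_exact _).1 h.unop

lemma unop_homologyι_surjective : Function.Surjective (K.homologyι n).unop.hom :=
  (ModuleCat.epi_iff_surjective _).1 inferInstance

variable {K n}

lemma exists_isClassOf {f : (K.X n).unop} (hf : (K.d (n + 1) n).unop f = 0) :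
    ∃ ξ, IsClassOf K n f ξ := by
  obtain ⟨z, hz⟩ := (exact_unop_pOpcycles K n f).1 hf
  exact ⟨_, z, hz, rfl⟩

lemma exists_isClassOf_right (ξ : (K.homology n).unop) :
    ∃ f, (K.d (n + 1) n).unop f = 0 ∧ IsClassOf K n f ξ := by
  obtain ⟨z, hz⟩ := unop_homologyι_surjective K n ξ
  exact ⟨(K.pOpcycles n).unop z, (exact_unop_pOpcycles K n _).2 ⟨z, rfl⟩, z, rfl, hz⟩

lemma IsClassOf.eq_zero_iff {f : (K.X n).unop} {ξ : (K.homology n).unop}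
    (h : IsClassOf K n f ξ) :
    ξ = 0 ↔ ∃ g, (K.d n ((ComplexShape.down ℕ).next n)).unop g = f := by
  obtain ⟨z, rfl, rfl⟩ := h
  have hd : ∀ g, (K.d n ((ComplexShape.down ℕ).next n)).unop g =
      (K.pOpcycles n).unop ((K.fromOpcycles n ((ComplexShape.down ℕ).next n)).unop g) := by
    intro g
    rw [← K.p_fromOpcycles]
    rfl
  refine (exact_unop_fromOpcycles K n z).trans ⟨?_, ?_⟩
  · rintro ⟨g, rfl⟩
    exact ⟨g, hd g⟩
  · rintro ⟨g, hg⟩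
    exact ⟨g, unop_pOpcycles_injective K n ((hd g).symm.trans hg)⟩

lemma IsClassOf.map {L : ChainComplex (ModuleCat.{u} R)ᵒᵖ ℕ} (φ : K ⟶ L)
    {f : (L.X n).unop} {ξ : (L.homology n).unop} (h : IsClassOf L n f ξ) :
    IsClassOf K n ((φ.f n).unop f) ((HomologicalComplex.homologyMap φ n).unop ξ) := by
  obtain ⟨z, rfl, rfl⟩ := h
  refine ⟨(HomologicalComplex.opcyclesMap φ n).unop z, ?_, ?_⟩
  · have := congrArg Quiver.Hom.unop (HomologicalComplex.p_opcyclesMap φ n)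
    exact congr($(this) z)
  · have := congrArg Quiver.Hom.unop (HomologicalComplex.homologyι_naturality φ n)
    exact congr($(this) z).symm

end ChainComplex

/-! ### Cocycle representatives for the two versions of Ext -/

namespace CategoryTheory.ProjectiveResolution

variable {R : Type u} [CommRing R] {X : ModuleCat.{u} R} (P : ProjectiveResolution X)
  {Y : ModuleCat.{u} R} {n : ℕ}

/-- The class `ξ` in `Ext R (ModuleCat R) n` is represented by the cocycle `f`. -/
def IsExtClassOf (f : P.complex.X n ⟶ Y)
    (ξ : ((Ext R (ModuleCat.{u} R) n).obj (Opposite.op X)).obj Y) : Prop :=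
  ChainComplex.IsClassOf ((((linearYoneda R (ModuleCat.{u} R)).obj Y).rightOp.mapHomologicalComplex
    (ComplexShape.down ℕ)).obj P.complex) n f
    ((P.isoLeftDerivedObj ((linearYoneda R (ModuleCat.{u} R)).obj Y).rightOp n).inv.unop ξ)

variable {P}

lemma exists_isExtClassOf {f : P.complex.X n ⟶ Y} (hf : P.complex.d (n + 1) n ≫ f = 0) :
    ∃ ξ, P.IsExtClassOf f ξ := by
  obtain ⟨ξ, h⟩ := ChainComplex.exists_isClassOf
    (K := (((linearYoneda R (ModuleCat.{u} R)).obj Y).rightOp.mapHomologicalComplex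
    (ComplexShape.down ℕ)).obj P.complex) (n := n) (f := f) hf
  let e := P.isoLeftDerivedObj ((linearYoneda R (ModuleCat.{u} R)).obj Y).rightOp n
  refine ⟨e.hom.unop ξ, ?_⟩
  have : e.inv.unop (e.hom.unop ξ) = ξ := congr($(congrArg Quiver.Hom.unop e.inv_hom_id) ξ)
  unfold IsExtClassOf
  rw [this]
  exact h

lemma exists_isExtClassOf_right (ξ : ((Ext R (ModuleCat.{u} R) n).obj (Opposite.op X)).obj Y) :
    ∃ f : P.complex.X n ⟶ Y, P.complex.d (n + 1) n ≫ f = 0 ∧ P.IsExtClassOf f ξ :=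
  ChainComplex.exists_isClassOf_right
    (K := (((linearYoneda R (ModuleCat.{u} R)).obj Y).rightOp.mapHomologicalComplex
    (ComplexShape.down ℕ)).obj P.complex) (n := n) _

lemma IsExtClassOf.eq_zero_iff {f : P.complex.X n ⟶ Y}
    {ξ : ((Ext R (ModuleCat.{u} R) n).obj (Opposite.op X)).obj Y} (h : P.IsExtClassOf f ξ) :
    ξ = 0 ↔ ∃ g, P.complex.d n ((ComplexShape.down ℕ).next n) ≫ g = f := by
  refine Iff.trans ?_ (ChainComplex.IsClassOf.eq_zero_iff h)
  let e := P.isoLeftDerivedObj ((linearYoneda R (ModuleCat.{u} R)).obj Y).rightOp n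
  have : e.hom.unop (e.inv.unop ξ) = ξ := congr($(congrArg Quiver.Hom.unop e.hom_inv_id) ξ)
  constructor
  · rintro rfl
    exact map_zero _
  · intro h0
    rw [← this]
    exact (congrArg e.hom.unop.hom h0).trans (map_zero _)

lemma IsExtClassOf.map {X' : ModuleCat.{u} R} {P' : ProjectiveResolution X'} {g : X' ⟶ X}
    (φ : Hom P' P g) {f : P.complex.X n ⟶ Y}
    {ξ : ((Ext R (ModuleCat.{u} R) n).obj (Opposite.op X)).obj Y} (h : P.IsExtClassOf f ξ) :
    P'.IsExtClassOf (φ.hom.f n ≫ f) ((((Ext R (ModuleCat.{u} R) n).map g.op).app Y) ξ) := by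
  have h2 := ChainComplex.IsClassOf.map
    ((((linearYoneda R (ModuleCat.{u} R)).obj Y).rightOp.mapHomologicalComplex
      (ComplexShape.down ℕ)).map φ.hom) h
  have := congrArg Quiver.Hom.unop (isoLeftDerivedObj_inv_naturality g P' P φ.hom
    φ.hom_f_zero_comp_π_f_zero ((linearYoneda R (ModuleCat.{u} R)).obj Y).rightOp n)
  have h3 := congr($(this) ξ)
  exact (congrArg (ChainComplex.IsClassOf _ n _) h3).mpr h2

/-- Lifts of morphisms to projective resolutions. -/
noncomputable def homLift {X' : ModuleCat.{u} R} (P' : ProjectiveResolution X')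
    (P : ProjectiveResolution X) (g : X' ⟶ X) : Hom P' P g where
  hom := lift g P' P
  hom_f_zero_comp_π_f_zero := lift_commutes_zero g P' P

open Abelian

/-- This is the same coboundary condition as in `IsExtClassOf.eq_zero_iff`, so vanishing can be
compared on cocycles without an isomorphism between the two Ext groups. Using `next` covers degree
0, where the differential is zero and the condition reads `f = 0`. -/
lemma extMk_eq_zero_iff_next (f : P.complex.X n ⟶ Y) (hf : P.complex.d (n + 1) n ≫ f = 0) :
    P.extMk f (n + 1) rfl hf = 0 ↔
      ∃ g, P.complex.d n ((ComplexShape.down ℕ).next n) ≫ g = f := by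
  rcases n with _ | n
  · simp only [← P.extEquivCohomologyClass.apply_eq_iff_eq,
      extEquivCohomologyClass_extMk, extEquivCohomologyClass_zero,
      CochainComplex.HomComplex.CohomologyClass.mk_eq_zero_iff]
    rw [CochainComplex.HomComplex.Cocycle.toSingleMk_mem_coboundaries_iff _ _ _ _ _ 1 (by simp)]
    have h0 : P.cochainComplex.d (-((0 : ℕ) : ℤ)) 1 = 0 := by
      apply IsZero.eq_of_tgt
      exact P.cochainComplex.isZero_of_isStrictlyLE 0 1 (by simp)
    have h1 : P.complex.d 0 ((ComplexShape.down ℕ).next 0) = 0 :=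
      P.complex.shape _ _ (by simp)
    simp only [h0, h1, zero_comp, exists_const]
    constructor
    · intro hg
      rw [← cancel_epi (P.cochainComplexXIso (-((0 : ℕ) : ℤ)) 0 rfl).hom, ← hg, comp_zero]
    · rintro rfl
      simp
  · rw [P.extMk_eq_zero_iff f _ rfl hf n rfl, ChainComplex.next_nat_succ]

end CategoryTheory.ProjectiveResolution

/-! ### Transfer of vanishing between the two versions of Ext -/

namespace CategoryTheory.Abelian.Ext

/-- Whether a class in `Ext` is annihilated by restriction along a system of morphisms does not
depend on the definition of `Ext`. -/
lemma forall_exists_mk₀_comp_eq_zero_iff {R : Type u} [CommRing R] {X Y : ModuleCat.{u} R} {n : ℕ}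
    {ι : Type*} (X' : ι → ModuleCat.{u} R) (g : ∀ i, X' i ⟶ X) :
    (∀ ξ : ((_root_.Ext R (ModuleCat.{u} R) n).obj (Opposite.op X)).obj Y,
      ∃ i, (((_root_.Ext R (ModuleCat.{u} R) n).map (g i).op).app Y) ξ = 0) ↔
    ∀ e : Ext X Y n, ∃ i, (mk₀ (g i)).comp e (zero_add n) = 0 := by
  let P := ProjectiveResolution.of X
  let P' i := ProjectiveResolution.of (X' i)
  have key {f : P.complex.X n ⟶ Y} {ξ} (hf : P.complex.d (n + 1) n ≫ f = 0)
      (h : P.IsExtClassOf f ξ) (i : ι) :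
      (((_root_.Ext R (ModuleCat.{u} R) n).map (g i).op).app Y) ξ = 0 ↔
        (mk₀ (g i)).comp (P.extMk f (n + 1) rfl hf) (zero_add n) = 0 := by
    rw [ProjectiveResolution.mk₀_comp_extMk f (n + 1) rfl hf
      (ProjectiveResolution.homLift (P' i) P (g i)),
      ProjectiveResolution.extMk_eq_zero_iff_next]
    exact (h.map (ProjectiveResolution.homLift (P' i) P (g i))).eq_zero_iff
  constructor
  · intro h e
    obtain ⟨f, hf, rfl⟩ := P.extMk_surjective e (n + 1) rfl
    obtain ⟨ξ, hξ⟩ := ProjectiveResolution.exists_isExtClassOf hf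
    obtain ⟨i, hi⟩ := h ξ
    exact ⟨i, (key hf hξ i).1 hi⟩
  · intro h ξ
    obtain ⟨f, hf, hξ⟩ := ProjectiveResolution.exists_isExtClassOf_right (P := P) ξ
    obtain ⟨i, hi⟩ := h (P.extMk f (n + 1) rfl hf)
    exact ⟨i, (key hf hξ i).2 hi⟩

end CategoryTheory.Abelian.Ext

/-! ### Vanishing of local cohomology in terms of Ext -/

namespace localCohomology

variable {R : Type u} [CommRing R] (I : Ideal R)

/-- The transition map `R ⧸ I ^ t' ⟶ R ⧸ I ^ t` for `t ≤ t'`. -/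
def powQuot {t t' : ℕ} (h : t ≤ t') :
    ModuleCat.of R (R ⧸ I ^ t') ⟶ ModuleCat.of R (R ⧸ I ^ t) :=
  ModuleCat.ofHom (Submodule.mapQ _ _ LinearMap.id (Ideal.pow_le_pow_right h))

open Opposite in
lemma isZero_iff_forall_exists_map_eq_zero (i : ℕ) (N : ModuleCat.{u} R) :
    IsZero ((localCohomology I i).obj N) ↔
      ∀ t, ∀ ξ : ((_root_.Ext R (ModuleCat.{u} R) i).obj (op (ModuleCat.of R (R ⧸ I ^ t)))).obj N,
        ∃ t' : {t' : ℕ // t ≤ t'},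
          (((_root_.Ext R (ModuleCat.{u} R) i).map (powQuot I t'.2).op).app N) ξ = 0 := by
  let F := diagram (idealPowersDiagram I) i
  -- Evaluation at `N` turns the colimit of functors into a filtered colimit of modules, where an
  -- element is zero iff a representative dies at a later stage.
  let e : (localCohomology I i).obj N ≅ colimit (F ⋙ (evaluation _ _).obj N) :=
    preservesColimitIso ((evaluation _ _).obj N) F
  have := preservesSmallestFilteredColimits_of_preservesFilteredColimits
    (forget (ModuleCat.{u} R))
  rw [e.isZero_iff, ModuleCat.isZero_iff_subsingleton]
  constructor
  · intro h t ξ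
    obtain ⟨j', a, ha⟩ := Concrete.colimit_rep_eq_zero R (F ⋙ (evaluation _ _).obj N) (op (op t)) ξ
      (Subsingleton.elim _ _)
    exact ⟨⟨j'.unop.unop, a.unop.unop.down.down⟩, ha⟩
  · intro h
    refine ⟨fun x y => ?_⟩
    suffices H : ∀ x : ↑(colimit (F ⋙ (evaluation _ _).obj N)), x = 0 by rw [H x, H y]
    intro x
    obtain ⟨j, ξ, rfl⟩ := Concrete.colimit_exists_rep _ x
    obtain ⟨t', ht'⟩ := h j.unop.unop ξ
    let a : j ⟶ op (op t'.1) := (show (op t'.1 : ℕᵒᵖ) ⟶ j.unop from (homOfLE t'.2).op).op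
    have h1 := colimit.w (F ⋙ (evaluation _ _).obj N) a
    rw [← h1]
    change (colimit.ι (F ⋙ (evaluation _ _).obj N) (op (op t'.1))).hom _ = 0
    exact (congrArg _ ht').trans (map_zero _)

open Abelian in
/-- The local cohomology module `H^i_I(N)` vanishes if and only if each class in
`Ext^i(R/I^t, N)` is annihilated by restriction to some `R/I^t'`. -/
theorem isZero_iff (i : ℕ) (N : ModuleCat.{u} R) :
    IsZero ((localCohomology I i).obj N) ↔
      ∀ t, ∀ e : Ext (ModuleCat.of R (R ⧸ I ^ t)) N i,
        ∃ t' : {t' : ℕ // t ≤ t'}, (Ext.mk₀ (powQuot I t'.2)).comp e (zero_add i) = 0 := by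
  rw [isZero_iff_forall_exists_map_eq_zero]
  exact forall_congr' fun t => Ext.forall_exists_mk₀_comp_eq_zero_iff _ _

end localCohomology

/-! ### Exactness properties of local cohomology -/

namespace localCohomology

open Abelian

variable {R : Type u} [CommRing R] (I : Ideal R)

lemma powQuot_comp {t t' t'' : ℕ} (h : t ≤ t') (h' : t' ≤ t'') :
    powQuot I h' ≫ powQuot I h = powQuot I (h.trans h') := by
  refine ModuleCat.hom_ext (LinearMap.ext fun x => ?_)
  obtain ⟨x, rfl⟩ := Submodule.mkQ_surjective _ x
  rfl

variable {I}

section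

variable {A B C : Type u} [AddCommGroup A] [Module R A] [AddCommGroup B] [Module R B]
  [AddCommGroup C] [Module R C]

lemma isZero_of_equiv (e : A ≃ₗ[R] B) {i : ℕ}
    (h : IsZero ((localCohomology I i).obj (ModuleCat.of R A))) :
    IsZero ((localCohomology I i).obj (ModuleCat.of R B)) :=
  h.of_iso ((localCohomology I i).mapIso e.symm.toModuleIso)

lemma isZero_of_subsingleton [Subsingleton A] (i : ℕ) :
    IsZero ((localCohomology I i).obj (ModuleCat.of R A)) := by
  rw [isZero_iff]
  intro t e
  refine ⟨⟨t, le_rfl⟩, ?_⟩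
  have h0 : IsZero (ModuleCat.of R A) := ModuleCat.isZero_of_subsingleton _
  rw [← e.comp_mk₀_id, h0.eq_of_src (𝟙 _) 0, Ext.mk₀_zero, Ext.comp_zero, Ext.comp_zero]

variable {f : A →ₗ[R] B} {g : B →ₗ[R] C} (hf : Function.Injective f)
  (hg : Function.Surjective g) (hfg : Function.Exact f g) {i : ℕ}

include hf hg hfg

lemma shortExact_of_exact :
    (ShortComplex.mk (ModuleCat.ofHom f) (ModuleCat.ofHom g)
      (by ext x; exact hfg.apply_apply_eq_zero x)).ShortExact :=
  ModuleCat.shortComplex_shortExact _ hfg hf hg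

/-- Local cohomology is exact in the middle. -/
lemma isZero_middle (hA : IsZero ((localCohomology I i).obj (ModuleCat.of R A)))
    (hC : IsZero ((localCohomology I i).obj (ModuleCat.of R C))) :
    IsZero ((localCohomology I i).obj (ModuleCat.of R B)) := by
  have hS := shortExact_of_exact hf hg hfg
  rw [isZero_iff] at hA hC ⊢
  intro t e
  -- Once the image in `C` dies at stage `t₁`, the restricted class lifts to `A`, and the lift dies
  -- at a stage `t₂`.
  obtain ⟨⟨t₁, h₁⟩, he₁⟩ := hC t (e.comp (Ext.mk₀ (ModuleCat.ofHom g)) (add_zero i))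
  rw [← Ext.comp_assoc_of_third_deg_zero] at he₁
  obtain ⟨a, ha⟩ := Ext.covariant_sequence_exact₂ _ hS _ he₁
  obtain ⟨⟨t₂, h₂⟩, he₂⟩ := hA t₁ a
  refine ⟨⟨t₂, h₁.trans h₂⟩, ?_⟩
  rw [← powQuot_comp I h₁ h₂, ← Ext.mk₀_comp_mk₀_assoc, ← ha,
    ← Ext.comp_assoc_of_third_deg_zero, he₂, Ext.zero_comp]

/-- Vanishing of local cohomology of a quotient, from the connecting homomorphism. -/
lemma isZero_right (hB : IsZero ((localCohomology I i).obj (ModuleCat.of R B)))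
    (hA : IsZero ((localCohomology I (i + 1)).obj (ModuleCat.of R A))) :
    IsZero ((localCohomology I i).obj (ModuleCat.of R C)) := by
  have hS := shortExact_of_exact hf hg hfg
  rw [isZero_iff] at hA hB ⊢
  intro t e
  obtain ⟨⟨t₁, h₁⟩, he₁⟩ := hA t (e.comp hS.extClass rfl)
  rw [← Ext.comp_assoc _ _ _ (zero_add i) rfl (by lia)] at he₁
  obtain ⟨b, hb⟩ := Ext.covariant_sequence_exact₃ _ hS _ rfl he₁
  obtain ⟨⟨t₂, h₂⟩, he₂⟩ := hB t₁ b
  refine ⟨⟨t₂, h₁.trans h₂⟩, ?_⟩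
  rw [← powQuot_comp I h₁ h₂, ← Ext.mk₀_comp_mk₀_assoc, ← hb,
    ← Ext.comp_assoc_of_third_deg_zero, he₂, Ext.zero_comp]

end

/-- If ideals cofinal with the powers of `I` have quotients of projective dimension less than `d`,
then local cohomology vanishes in degrees at least `d`. -/
lemma isZero_of_hasProjectiveDimensionLT (d : ℕ)
    (h : ∀ t, ∃ J : Ideal R, J ≤ I ^ t ∧ (∃ t', I ^ t' ≤ J) ∧
      HasProjectiveDimensionLT (ModuleCat.of R (R ⧸ J)) d)
    {i : ℕ} (hi : d ≤ i) (N : ModuleCat.{u} R) : IsZero ((localCohomology I i).obj N) := by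
  rw [isZero_iff]
  intro t e
  obtain ⟨J, hJ, ⟨t', ht'⟩, hd⟩ := h t
  have h₁ : I ^ (max t t') ≤ J := (Ideal.pow_le_pow_right (le_max_right _ _)).trans ht'
  refine ⟨⟨max t t', le_max_left _ _⟩, ?_⟩
  let a : ModuleCat.of R (R ⧸ I ^ max t t') ⟶ ModuleCat.of R (R ⧸ J) :=
    ModuleCat.ofHom (Submodule.mapQ _ _ LinearMap.id h₁)
  let b : ModuleCat.of R (R ⧸ J) ⟶ ModuleCat.of R (R ⧸ I ^ t) :=
    ModuleCat.ofHom (Submodule.mapQ _ _ LinearMap.id hJ)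
  -- The transition map factors through `R ⧸ J`, whose Ext in degree `i` vanishes.
  have hab : powQuot I (le_max_left t t') = a ≫ b := by
    refine ModuleCat.hom_ext (LinearMap.ext fun x => ?_)
    obtain ⟨x, rfl⟩ := Submodule.mkQ_surjective _ x
    rfl
  rw [hab, ← Ext.mk₀_comp_mk₀_assoc,
    Ext.eq_zero_of_hasProjectiveDimensionLT ((Ext.mk₀ b).comp e (zero_add i)) d hi, Ext.comp_zero]

end localCohomology

/-! ### Vanishing above the number of variables -/

/-- Adding to `J` an element which is regular modulo `J` raises the projective dimension of the
quotient by at most one. -/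
lemma Ideal.hasProjectiveDimensionLT_quotient_sup_span {R : Type u} [CommRing R] (J : Ideal R)
    (x : R) (hx : ∀ f, x * f ∈ J → f ∈ J) (d : ℕ)
    (hJ : HasProjectiveDimensionLT (ModuleCat.of R (R ⧸ J)) d) :
    HasProjectiveDimensionLT (ModuleCat.of R (R ⧸ (J ⊔ Ideal.span {x}))) (d + 1) := by
  let f : (R ⧸ J) →ₗ[R] (R ⧸ J) := LinearMap.lsmul R _ x
  let g : (R ⧸ J) →ₗ[R] (R ⧸ (J ⊔ Ideal.span {x})) :=
    Submodule.mapQ _ _ LinearMap.id le_sup_left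
  have hf : Function.Injective f := by
    rw [injective_iff_map_eq_zero]
    intro a ha
    obtain ⟨a, rfl⟩ := Ideal.Quotient.mk_surjective a
    exact Ideal.Quotient.eq_zero_iff_mem.2 (hx a (Ideal.Quotient.eq_zero_iff_mem.1 ha))
  have hg : Function.Surjective g := by
    intro y
    obtain ⟨y, rfl⟩ := Submodule.mkQ_surjective _ y
    exact ⟨Submodule.mkQ _ y, rfl⟩
  have hfg : Function.Exact f g := by
    intro a
    obtain ⟨a, rfl⟩ := Ideal.Quotient.mk_surjective a
    constructor
    · intro h
      have h : a ∈ J ⊔ Ideal.span {x} := Ideal.Quotient.eq_zero_iff_mem.1 h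
      obtain ⟨j, hj, z, hz, rfl⟩ := Submodule.mem_sup.1 h
      obtain ⟨c, rfl⟩ := Ideal.mem_span_singleton'.1 hz
      refine ⟨Ideal.Quotient.mk J c, ?_⟩
      rw [map_add, Ideal.Quotient.eq_zero_iff_mem.2 hj, zero_add, mul_comm]
      rfl
    · rintro ⟨c, hc⟩
      obtain ⟨c, rfl⟩ := Ideal.Quotient.mk_surjective c
      rw [← hc]
      exact Ideal.Quotient.eq_zero_iff_mem.2
        (Ideal.mem_sup_right (Ideal.mem_span_singleton'.2 ⟨c, mul_comm _ _⟩))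
  exact (localCohomology.shortExact_of_exact hf hg hfg).hasProjectiveDimensionLT_X₃ d hJ
    (hasProjectiveDimensionLT_of_ge _ d (d + 1) (Nat.le_succ d))

namespace MvPolynomial

lemma mem_span_X_pow_image {R σ : Type*} [CommSemiring R] {s : Set σ} {t : ℕ}
    {x : MvPolynomial σ R} :
    x ∈ Ideal.span ((fun i => (X i : MvPolynomial σ R) ^ t) '' s) ↔
      ∀ m ∈ x.support, ∃ i ∈ s, t ≤ m i := by
  have := @mem_ideal_span_monomial_image σ R _ x ((fun i => Finsupp.single i t) '' s)
  rw [Set.image_image] at this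
  simp only [X_pow_eq_monomial]
  rw [this]
  simp

/-- Multiplication by `X a ^ t` changes only the exponent of `a`, and membership in this monomial
ideal depends only on the exponents of the variables in `s`. -/
lemma mem_span_X_pow_image_of_mul_mem {R σ : Type*} [CommSemiring R] {s : Set σ} {t : ℕ}
    {a : σ} (ha : a ∉ s) {x : MvPolynomial σ R}
    (hx : X a ^ t * x ∈ Ideal.span ((fun i => (X i : MvPolynomial σ R) ^ t) '' s)) :
    x ∈ Ideal.span ((fun i => (X i : MvPolynomial σ R) ^ t) '' s) := by
  classical
  rw [mem_span_X_pow_image] at hx ⊢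
  intro m hm
  obtain ⟨i, hi, h⟩ := hx (Finsupp.single a t + m) (by
    rw [mem_support_iff, X_pow_eq_monomial, coeff_monomial_mul, one_mul]
    exact mem_support_iff.1 hm)
  refine ⟨i, hi, ?_⟩
  have hne : a ≠ i := fun h => ha (h ▸ hi)
  simpa [hne] using h

/-- Each new power is regular modulo the earlier ones and costs one dimension. The bound is strict,
so the free module for `s = ∅` already needs 1. -/
lemma hasProjectiveDimensionLT_quotient_span_X_pow {R : Type u} [CommRing R] {σ : Type}
    (s : Finset σ) (t : ℕ) :
    HasProjectiveDimensionLT (ModuleCat.of (MvPolynomial σ R)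
      (MvPolynomial σ R ⧸ Ideal.span ((fun i => (X i : MvPolynomial σ R) ^ t) '' s)))
      (s.card + 1) := by
  classical
  induction s using Finset.induction_on with
  | empty =>
    have h : Ideal.span ((fun i => (X i : MvPolynomial σ R) ^ t) '' ((∅ : Finset σ) : Set σ)) =
        ⊥ := by simp
    rw [h]
    have e : (MvPolynomial σ R) ≃ₗ[MvPolynomial σ R]
        (MvPolynomial σ R ⧸ (⊥ : Ideal (MvPolynomial σ R))) :=
      (Submodule.quotEquivOfEqBot ⊥ rfl).symm
    have : Module.Projective (MvPolynomial σ R)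
        (MvPolynomial σ R ⧸ (⊥ : Ideal (MvPolynomial σ R))) := Module.Projective.of_equiv e
    have : Projective (ModuleCat.of (MvPolynomial σ R)
        (MvPolynomial σ R ⧸ (⊥ : Ideal (MvPolynomial σ R)))) :=
      (IsProjective.iff_projective _).1 this
    rw [Finset.card_empty, zero_add]
    infer_instance
  | insert a s ha ih =>
    rw [Finset.card_insert_of_notMem ha, Finset.coe_insert, Set.image_insert_eq,
      Ideal.span_insert, sup_comm]
    exact Ideal.hasProjectiveDimensionLT_quotient_sup_span _ _
      (fun f hf => mem_span_X_pow_image_of_mul_mem (by simpa using ha) hf) _ ih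

/-- Local cohomology of a polynomial ring with respect to an ideal generated by `d` variables
vanishes in degrees greater than `d`. -/
theorem isZero_localCohomology_of_card_lt {R : Type u} [CommRing R] {σ : Type}
    (s : Finset σ) {i : ℕ} (hi : s.card < i) (N : ModuleCat.{u} (MvPolynomial σ R)) :
    IsZero ((localCohomology (Ideal.span (X '' (s : Set σ))) i).obj N) := by
  refine localCohomology.isZero_of_hasProjectiveDimensionLT (s.card + 1) (fun t => ?_) hi N
  refine ⟨Ideal.span ((fun i => (X i : MvPolynomial σ R) ^ t) '' s), ?_, ?_,
    hasProjectiveDimensionLT_quotient_span_X_pow s t⟩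
  · rw [Ideal.span_le]
    rintro _ ⟨i, hi, rfl⟩
    exact Ideal.pow_mem_pow (Ideal.subset_span (Set.mem_image_of_mem _ hi)) t
  · refine Ideal.exists_pow_le_of_le_radical_of_fg ?_
      (Submodule.fg_span (s.finite_toSet.image _))
    rw [Ideal.span_le]
    rintro _ ⟨i, hi, rfl⟩
    exact Ideal.mem_radical_iff.2
      ⟨t, Ideal.subset_span (Set.mem_image_of_mem (fun i => (X i : MvPolynomial σ R) ^ t) hi)⟩

end MvPolynomial

/-! ### Vanishing of local cohomology and the support -/

namespace localCohomology

variable {R : Type u} [CommRing R] [IsNoetherianRing R] {I : Ideal R}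

/-- Local cohomology of a finitely generated module vanishes in degree `i` if this is true of
`R ⧸ p` for all primes `p` in the support. -/
lemma isZero_of_forall_prime {i : ℕ} {N : Type u} [AddCommGroup N] [Module R N]
    [hN : Module.Finite R N]
    (h : ∀ p : Ideal R, p.IsPrime → Module.annihilator R N ≤ p →
      IsZero ((localCohomology I i).obj (ModuleCat.of R (R ⧸ p)))) :
    IsZero ((localCohomology I i).obj (ModuleCat.of R N)) := by
  induction hN using IsNoetherianRing.induction_on_isQuotientEquivQuotientPrime R with
  | subsingleton N => exact isZero_of_subsingleton i
  | quotient N p e =>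
    refine isZero_of_equiv e.symm (h p.1 p.2 ?_)
    rw [e.annihilator_eq, Ideal.annihilator_quotient]
  | exact N₁ N₂ N₃ f g hf hg hfg h₁ h₃ =>
    exact isZero_middle hf hg hfg
      (h₁ fun p hp hle => h p hp ((f.annihilator_le_of_injective hf).trans hle))
      (h₃ fun p hp hle => h p hp ((g.annihilator_le_of_surjective hg).trans hle))

/-- Hom(L, R/p) vanishes only if Ann(L) contains an element regular on R/p, but elements of `p` act
as zero on R/p ≠ 0. -/
lemma exists_ne_zero_linearMap_quotient (L : Type u) [AddCommGroup L] [Module R L]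
    [Module.Finite R L] (p : Ideal R) [p.IsPrime] (h : Module.annihilator R L ≤ p) :
    ∃ φ : L →ₗ[R] R ⧸ p, φ ≠ 0 := by
  have h1 : ¬ Subsingleton (L →ₗ[R] R ⧸ p) := by
    rw [IsSMulRegular.subsingleton_linearMap_iff]
    rintro ⟨r, hr, hreg⟩
    have h2 : (1 : R ⧸ p) = 0 := hreg (by
      change r • (1 : R ⧸ p) = r • 0
      rw [smul_zero, Algebra.smul_def, mul_one]
      exact Ideal.Quotient.eq_zero_iff_mem.2 (h hr))
    exact one_ne_zero h2
  rw [not_subsingleton_iff_nontrivial] at h1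
  exact exists_ne 0

/-- If the local cohomology of a finitely generated module `L` vanishes in all degrees at least `i`
(and local cohomology vanishes in large degrees), then so does that of `R ⧸ p`, for `p` in the
support of `L`. -/
theorem isZero_quotient_prime {d : ℕ}
    (hd : ∀ i, d < i → ∀ N : ModuleCat.{u} R, IsZero ((localCohomology I i).obj N))
    {L : Type u} [AddCommGroup L] [Module R L] [Module.Finite R L] {k : ℕ}
    (hL : ∀ i, k ≤ i → IsZero ((localCohomology I i).obj (ModuleCat.of R L)))
    (i : ℕ) (hi : k ≤ i) (p : Ideal R) (hp : p.IsPrime) (hLp : Module.annihilator R L ≤ p) :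
    IsZero ((localCohomology I i).obj (ModuleCat.of R (R ⧸ p))) := by
  by_cases hid : d < i
  · exact hd i hid _
  -- Descending induction on the degree, starting above `d`; within one degree, Noetherian induction
  -- assumes the claim for the larger primes.
  induction hn : d + 1 - i generalizing i p with
  | zero => omega
  | succ n ih =>
    have ih' : ∀ p : Ideal R, p.IsPrime → Module.annihilator R L ≤ p →
        IsZero ((localCohomology I (i + 1)).obj (ModuleCat.of R (R ⧸ p))) := by
      intro p hp hLp
      by_cases h : d < i + 1
      · exact hd _ h _
      · exact ih (i + 1) (by omega) p hp hLp h (by omega)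
    clear ih
    induction p using WellFoundedGT.induction with
    | ind p ihp =>
      obtain ⟨φ, hφ⟩ := exists_ne_zero_linearMap_quotient L p hLp
      have hker : IsZero ((localCohomology I (i + 1)).obj (ModuleCat.of R (LinearMap.ker φ))) :=
        isZero_of_forall_prime fun q hq hle => ih' q hq
          (((LinearMap.ker φ).subtype.annihilator_le_of_injective
            (Submodule.injective_subtype _)).trans hle)
      -- The image of `φ` lies between H^i(L) = 0 and H^{i+1}(ker φ) = 0 in the long exact sequence.
      have hrange : IsZero ((localCohomology I i).obj (ModuleCat.of R (LinearMap.range φ))) :=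
        isZero_right (f := (LinearMap.ker φ).subtype) (g := φ.rangeRestrict)
          (Submodule.injective_subtype _) φ.surjective_rangeRestrict
          (by rw [LinearMap.exact_iff, LinearMap.ker_rangeRestrict, Submodule.range_subtype])
          (hL i hi) hker
      refine isZero_middle (f := (LinearMap.range φ).subtype) (g := (LinearMap.range φ).mkQ)
        (Submodule.injective_subtype _) (Submodule.mkQ_surjective _)
        (LinearMap.exact_subtype_mkQ _) hrange (isZero_of_forall_prime fun q hq hle => ?_)
      -- A lift `a` of a nonzero value of `φ` kills the cokernel and is not in `p`, so every prime
      -- over the annihilator of the cokernel is strictly larger than `p`.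
      obtain ⟨x, hx⟩ : ∃ x, φ x ≠ 0 := by
        by_contra! h
        exact hφ (LinearMap.ext h)
      obtain ⟨a, ha⟩ := Ideal.Quotient.mk_surjective (φ x)
      have hpq : p ≤ q := by
        refine le_trans ?_ hle
        refine le_trans (Ideal.annihilator_quotient (I := p)).ge ?_
        exact (LinearMap.range φ).mkQ.annihilator_le_of_surjective (Submodule.mkQ_surjective _)
      have haq : a ∈ q := by
        refine hle (Module.mem_annihilator.2 fun y => ?_)
        obtain ⟨y, rfl⟩ := Submodule.mkQ_surjective _ y
        obtain ⟨b, rfl⟩ := Ideal.Quotient.mk_surjective y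
        rw [← map_smul]
        refine (Submodule.Quotient.mk_eq_zero _).2 ⟨b • x, ?_⟩
        rw [map_smul, ← ha, Algebra.smul_def, Algebra.smul_def]
        exact mul_comm _ _
      have hap : a ∉ p := fun h => hx (by rw [← ha, Ideal.Quotient.eq_zero_iff_mem.2 h])
      exact ihp q (lt_of_le_of_ne hpq fun h => hap (h ▸ haq)) hq (hLp.trans hpq)

end localCohomology

/-! ### Cohomological dimension and the support -/

section cohomDim

variable {R : Type u} [CommRing R] {I : Ideal R}

lemma cohomDim_le_iff {M : Type u} [AddCommGroup M] [Module R M] {c : WithBot ℕ∞} :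
    cohomDim I M ≤ c ↔ ∀ k : ℕ, ¬ IsZero ((localCohomology I k).obj (ModuleCat.of R M)) →
      ((k : ℕ∞) : WithBot ℕ∞) ≤ c :=
  iSup₂_le_iff

lemma isZero_of_cohomDim_lt {M : Type u} [AddCommGroup M] [Module R M] {k : ℕ}
    (h : cohomDim I M < ((k : ℕ∞) : WithBot ℕ∞)) :
    IsZero ((localCohomology I k).obj (ModuleCat.of R M)) := by
  by_contra hk
  exact (cohomDim_le_iff.1 le_rfl k hk).not_gt h

variable [IsNoetherianRing R]

lemma cohomDim_le_of_forall_prime {N : Type u} [AddCommGroup N] [Module R N] [Module.Finite R N]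
    {c : WithBot ℕ∞}
    (h : ∀ p : Ideal R, p.IsPrime → Module.annihilator R N ≤ p → cohomDim I (R ⧸ p) ≤ c) :
    cohomDim I N ≤ c := by
  rw [cohomDim_le_iff]
  intro k hk
  by_contra! hc
  exact hk (localCohomology.isZero_of_forall_prime fun p hp hle =>
    isZero_of_cohomDim_lt ((h p hp hle).trans_lt hc))

/-- Above cd(I, L) all local cohomology of `L` vanishes, which is the input of
`isZero_quotient_prime`; `hd` starts its descending induction. -/
lemma cohomDim_quotient_le {d : ℕ}
    (hd : ∀ i, d < i → ∀ N : ModuleCat.{u} R, IsZero ((localCohomology I i).obj N))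
    {L : Type u} [AddCommGroup L] [Module R L] [Module.Finite R L] (p : Ideal R) (hp : p.IsPrime)
    (h : Module.annihilator R L ≤ p) : cohomDim I (R ⧸ p) ≤ cohomDim I L := by
  rw [cohomDim_le_iff]
  intro k hk
  by_contra! hc
  refine hk (localCohomology.isZero_quotient_prime hd (L := L) (k := k) (fun i hi => ?_)
    k le_rfl p hp h)
  exact isZero_of_cohomDim_lt (hc.trans_le (by exact_mod_cast hi))

/-- The cohomological dimension is monotone in the support. -/
lemma cohomDim_le_of_annihilator_le {d : ℕ}
    (hd : ∀ i, d < i → ∀ N : ModuleCat.{u} R, IsZero ((localCohomology I i).obj N))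
    {N L : Type u} [AddCommGroup N] [Module R N] [Module.Finite R N]
    [AddCommGroup L] [Module R L] [Module.Finite R L]
    (h : Module.annihilator R L ≤ Module.annihilator R N) : cohomDim I N ≤ cohomDim I L :=
  cohomDim_le_of_forall_prime fun p hp hle => cohomDim_quotient_le hd p hp (h.trans hle)

end cohomDim

lemma isZero_localCohomology_idealQ {K : Type u} [Field K] (m n : ℕ) (i : ℕ) (hi : n < i)
    (N : ModuleCat.{u} (BiPoly K m n)) : IsZero ((localCohomology (idealQ K m n) i).obj N) := by
  have h : idealQ K m n = Ideal.span (MvPolynomial.X ''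
      ((Finset.univ.map Function.Embedding.inr : Finset (Fin m ⊕ Fin n)) :
        Set (Fin m ⊕ Fin n))) := by
    rw [idealQ, Finset.coe_map, Finset.coe_univ, Set.image_univ, ← Set.range_comp]
    rfl
  rw [h]
  exact MvPolynomial.isZero_localCohomology_of_card_lt _ (by simpa using hi) N

/-! ### Homogeneous witnesses for associated primes -/

section graded

open DirectSum

variable {ι R M σ τ : Type*} [DecidableEq ι] [AddCommGroup M]

namespace Submodule

variable [CommRing R] [Module R M]

/-- No other summand has the degree of `y a`, so `y a` is a full homogeneous component of the sum.
The other degrees may collide. -/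
lemma IsHomogeneous.mem_of_sum_mem [SetLike τ M] [AddSubgroupClass τ M] {ℳ : ι → τ}
    [Decomposition ℳ] {D : Submodule R M}
    (hD : D.IsHomogeneous ℳ) {α : Type*} {s : Finset α} {y : α → M}
    {deg : α → ι} (hy : ∀ a ∈ s, y a ∈ ℳ (deg a)) (h : ∑ a ∈ s, y a ∈ D) {a : α} (ha : a ∈ s)
    (hdeg : ∀ b ∈ s, deg b = deg a → b = a) : y a ∈ D := by
  have h1 := hD (deg a) h
  rw [decompose_sum, DFinsupp.finsetSum_apply, AddSubmonoidClass.coe_finsetSum,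
    Finset.sum_eq_single a, decompose_of_mem_same _ (hy a ha)] at h1
  · exact h1
  · intro b hb hba
    exact decompose_of_mem_ne _ (hy b hb) fun h => hba (hdeg b hb h)
  · exact fun h => (h ha).elim

lemma IsHomogeneous.sup [SetLike τ M] [AddSubgroupClass τ M] {ℳ : ι → τ}
    [Decomposition ℳ] {N D : Submodule R M}
    (hN : N.IsHomogeneous ℳ) (hD : D.IsHomogeneous ℳ) : (N ⊔ D).IsHomogeneous ℳ := by
  intro i x hx
  obtain ⟨a, ha, b, hb, rfl⟩ := Submodule.mem_sup.1 hx
  rw [decompose_add, DFinsupp.add_apply, AddMemClass.coe_add]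
  exact Submodule.add_mem_sup (hN i ha) (hD i hb)

variable [AddCommGroup ι] [SetLike σ R] [AddSubgroupClass σ R] (𝒜 : ι → σ)
  [Decomposition 𝒜] [SetLike τ M] [AddSubgroupClass τ M] {ℳ : ι → τ}
  [Decomposition ℳ] [SetLike.GradedSMul 𝒜 ℳ]

include 𝒜

lemma isHomogeneous_span_singleton {z : M} {b : ι} (hz : z ∈ ℳ b) :
    (span R {z}).IsHomogeneous ℳ := by
  classical
  intro i x hx
  obtain ⟨r, rfl⟩ := mem_span_singleton.1 hx
  rw [← sum_support_decompose 𝒜 r, Finset.sum_smul, decompose_sum, DFinsupp.finsetSum_apply,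
    AddSubmonoidClass.coe_finsetSum]
  refine sum_mem fun a _ => ?_
  have h : (decompose 𝒜 r a : R) • z ∈ ℳ (a + b) :=
    SetLike.GradedSMul.smul_mem (decompose 𝒜 r a).2 hz
  by_cases hi : a + b = i
  · subst hi
    rw [decompose_of_mem_same _ h]
    exact smul_mem _ _ (mem_span_singleton_self z)
  · rw [decompose_of_mem_ne _ h hi]
    exact zero_mem _

variable [UniqueSums ι]

/-- Induction on the number of components. The shift `c` absorbs the degree of the homogeneous
multipliers, so that `B` only ever loses an element. -/
lemma exists_colon_eq_of_sum {D : Submodule R M} (hD : D.IsHomogeneous ℳ)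
    {p : Ideal R} (hp : p.IsPrime) (B : Finset ι) (c : ι) (y : ι → M)
    (hy : ∀ b ∈ B, y b ∈ ℳ (c + b)) (h : p = D.colon {∑ b ∈ B, y b}) :
    ∃ b, ∃ z ∈ ℳ b, p = D.colon {z} := by
  classical
  induction hn : B.card generalizing B c y with
  | zero =>
    rw [Finset.card_eq_zero.1 hn, Finset.sum_empty] at h
    refine absurd ?_ hp.ne_top
    rw [h, Ideal.eq_top_iff_one, mem_colon_singleton, smul_zero]
    exact zero_mem _
  | succ n ih =>
    have hB : B.Nonempty := Finset.card_pos.1 (by omega)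
    have hmem : ∀ r, r ∈ p ↔ r • ∑ b ∈ B, y b ∈ D := fun r => by rw [h, mem_colon_singleton]
    have hsmul : ∀ (f : R) (a : ι), ∀ b ∈ B, (decompose 𝒜 f a : R) • y b ∈ ℳ (a + (c + b)) :=
      fun f a b hb => SetLike.GradedSMul.smul_mem (decompose 𝒜 f a).2 (hy b hb)
    -- If `p` is homogeneous, it equals the intersection of the (D : y b), and a prime that is a
    -- finite intersection is one of its members.
    by_cases hhom : ∀ f ∈ p, ∀ a, (decompose 𝒜 f a : R) ∈ p
    · have hle : ∀ b ∈ B, p ≤ D.colon {y b} := by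
        intro b hb f hf
        rw [mem_colon_singleton, ← sum_support_decompose 𝒜 f, Finset.sum_smul]
        refine sum_mem fun a _ => ?_
        have h1 := (hmem _).1 (hhom f hf a)
        rw [Finset.smul_sum] at h1
        exact hD.mem_of_sum_mem (deg := fun b => a + (c + b)) (hsmul f a) h1 hb
          fun b' _ h => by simpa using h
      have hinf : B.inf (fun b => D.colon {y b}) ≤ p := by
        intro f hf
        rw [hmem, Finset.smul_sum]
        refine sum_mem fun b hb => mem_colon_singleton.1 ?_
        have hle : B.inf (fun b => D.colon {y b}) ≤ D.colon {y b} := Finset.inf_le hb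
        exact hle hf
      obtain ⟨b, hb, hbp⟩ := (Ideal.IsPrime.inf_le' hp).1 hinf
      exact ⟨_, y b, hy b hb, le_antisymm (hle b hb) hbp⟩
    · push Not at hhom
      obtain ⟨f, hf, a₁, ha₁⟩ := hhom
      -- Dropping the components of `f` that lie in `p` leaves an element of `p` none of whose
      -- components is in `p`.
      let A := (decompose 𝒜 f).support.filter fun a => (decompose 𝒜 f a : R) ∉ p
      have hA : A.Nonempty := ⟨a₁, Finset.mem_filter.2 ⟨by
        rw [DFinsupp.mem_support_iff]
        intro h0
        exact ha₁ (by rw [h0]; exact zero_mem _), ha₁⟩⟩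
      have hfA : ∑ a ∈ A, (decompose 𝒜 f a : R) ∈ p := by
        have h1 := Finset.sum_filter_add_sum_filter_not (decompose 𝒜 f).support
          (fun a => (decompose 𝒜 f a : R) ∉ p) fun a => (decompose 𝒜 f a : R)
        rw [sum_support_decompose 𝒜 f] at h1
        rw [← h1] at hf
        refine (Ideal.add_mem_iff_left _ (sum_mem fun a ha => ?_)).1 hf
        exact not_not.1 (Finset.mem_filter.1 ha).2
      -- The degree `a₀ + b₀` arises only once in the product, so the component of `f` of degree
      -- `a₀` sends `y b₀` into `D`. Multiplying by this component, which is outside the prime `p`,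
      -- keeps the colon ideal and removes `b₀`.
      obtain ⟨a₀, ha₀, b₀, hb₀, huniq⟩ := UniqueSums.uniqueAdd_of_nonempty hA hB
      have hkill : (decompose 𝒜 f a₀ : R) • y b₀ ∈ D := by
        have h1 := (hmem _).1 hfA
        rw [Finset.sum_smul_sum, ← Finset.sum_product'] at h1
        refine hD.mem_of_sum_mem (s := A ×ˢ B) (y := fun ab => (decompose 𝒜 f ab.1 : R) • y ab.2)
          (deg := fun ab => ab.1 + (c + ab.2)) (a := (a₀, b₀)) ?_ h1
          (Finset.mk_mem_product ha₀ hb₀) ?_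
        · intro ab hab
          exact hsmul f ab.1 ab.2 (Finset.mem_product.1 hab).2
        · rintro ⟨a, b⟩ hab h2
          obtain ⟨ha, hb⟩ := Finset.mem_product.1 hab
          simp only [add_left_comm _ c, add_right_inj] at h2
          obtain ⟨rfl, rfl⟩ := huniq ha hb h2
          rfl
      have hnot : (decompose 𝒜 f a₀ : R) ∉ p := (Finset.mem_filter.1 ha₀).2
      refine ih (B.erase b₀) (a₀ + c) (fun b => (decompose 𝒜 f a₀ : R) • y b) ?_ ?_ ?_
      · intro b hb
        rw [add_assoc]
        exact hsmul f a₀ b (Finset.mem_of_mem_erase hb)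
      · ext r
        have h2 : (r * (decompose 𝒜 f a₀ : R)) • ∑ b ∈ B, y b =
            r • ((decompose 𝒜 f a₀ : R) • y b₀) +
              r • ∑ b ∈ B.erase b₀, (decompose 𝒜 f a₀ : R) • y b := by
          rw [← smul_add, Finset.add_sum_erase B (fun b => (decompose 𝒜 f a₀ : R) • y b) hb₀,
            ← Finset.smul_sum, mul_smul]
        rw [mem_colon_singleton, ← add_mem_cancel_left (D.smul_mem r hkill), ← h2, ← hmem]
        exact ⟨fun hr => p.mul_mem_right _ hr, fun hr => (hp.mem_or_mem hr).resolve_right hnot⟩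
      · rw [Finset.card_erase_of_mem hb₀, hn, Nat.add_sub_cancel]

/-- A prime ideal of the form `(D : x)`, with `D` a homogeneous submodule of a graded module, is of
the form `(D : z)` with `z` homogeneous. -/
theorem exists_colon_eq_of_isPrime {D : Submodule R M} (hD : D.IsHomogeneous ℳ)
    {p : Ideal R} (hp : p.IsPrime) {x : M} (h : p = D.colon {x}) :
    ∃ b, ∃ z ∈ ℳ b, p = D.colon {z} := by
  classical
  refine exists_colon_eq_of_sum 𝒜 hD hp (decompose ℳ x).support 0
    (fun b => (decompose ℳ x b : M)) (fun b _ => ?_) ?_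
  · rw [zero_add]
    exact (decompose ℳ x b).2
  · rwa [sum_support_decompose ℳ x]

end Submodule

end graded

/-! ### The dimension filtration and its associated primes -/

open Submodule in
/-- A homogeneous submodule `N` with `cd(Q, N) ≤ cd(Q, D_i)` is contained in `D_i`. -/
lemma IsDimensionFiltration.le_of_cohomDim_le {K : Type u} [Field K] {m n : ℕ}
    {M : Type u} [AddCommGroup M] [Module (BiPoly K m n) M] [Module.Finite (BiPoly K m n) M]
    {ℳ : ℤ × ℤ → AddSubgroup M} [DirectSum.Decomposition ℳ]
    {r : ℕ} {D : Fin (r + 1) → Submodule (BiPoly K m n) M} (hD : IsDimensionFiltration ℳ D)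
    {N : Submodule (BiPoly K m n) M} (hN : N.IsHomogeneous ℳ) (i : Fin (r + 1))
    (h : cohomDim (idealQ K m n) N ≤ cohomDim (idealQ K m n) (D i)) : N ≤ D i := by
  suffices H : ∀ j, i ≤ j → N ≤ D j from H i le_rfl
  intro j
  induction j using Fin.reverseInduction with
  | last => exact fun _ => hD.last_eq_top ▸ le_top
  | cast j ih =>
    intro hij
    have hlt := (hD.isGreatest j).1.2.2
    -- Maximality is applied to N + D_j: a prime over its annihilator contains Ann(N) or Ann(D_j),
    -- so its cohomological dimension is at most cd(Q, D_j), as i ≤ j.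
    refine le_sup_left.trans ((hD.isGreatest j).2
      ⟨hN.sup (hD.isHomogeneous j.castSucc), sup_le (ih (hij.trans j.castSucc_lt_succ.le)) ?_, ?_⟩)
    · exact hD.strictMono.monotone j.castSucc_lt_succ.le
    · refine lt_of_le_of_lt (cohomDim_le_of_forall_prime fun q hq hle => ?_) hlt
      have h1 : Module.annihilator (BiPoly K m n) N ⊓
          Module.annihilator (BiPoly K m n) (D j.castSucc) ≤ q := by
        refine le_trans ?_ hle
        intro s hs
        rw [Module.mem_annihilator]
        rintro ⟨x, hx⟩
        obtain ⟨a, ha, b, hb, rfl⟩ := mem_sup.1 hx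
        have ha' := congrArg Subtype.val (Module.mem_annihilator.1 hs.1 ⟨a, ha⟩)
        have hb' := congrArg Subtype.val (Module.mem_annihilator.1 hs.2 ⟨b, hb⟩)
        refine Subtype.ext ?_
        change s • a = 0 at ha'
        change s • b = 0 at hb'
        change s • (a + b) = 0
        rw [smul_add, ha', hb', add_zero]
      rcases hq.inf_le.1 h1 with h2 | h2
      · refine (cohomDim_quotient_le (isZero_localCohomology_idealQ m n) q hq h2).trans (h.trans ?_)
        exact cohomDim_le_of_annihilator_le (isZero_localCohomology_idealQ m n)
          ((inclusion (hD.strictMono.monotone hij)).annihilator_le_of_injective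
            (inclusion_injective _))
      · exact cohomDim_quotient_le (isZero_localCohomology_idealQ m n) q hq h2

lemma Submodule.IsAssociatedPrime.exists_homogeneous {K : Type u} [Field K] {m n : ℕ}
    {M : Type u} [AddCommGroup M] [Module (BiPoly K m n) M]
    {ℳ : ℤ × ℤ → AddSubgroup M} [DirectSum.Decomposition ℳ]
    [SetLike.GradedSMul (bigrading K m n) ℳ]
    {N : Submodule (BiPoly K m n) M} {p : Ideal (BiPoly K m n)}
    (hp : N.IsAssociatedPrime p) (hN : N.IsHomogeneous ℳ) :
    ∃ b, ∃ z ∈ ℳ b, p = N.colon {z} := by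
  let := MvPolynomial.weightedDecomposition K (bidegree m n)
  obtain ⟨hp, x, hx⟩ := Submodule.isAssociatedPrime_iff.1 hp
  exact Submodule.exists_colon_eq_of_isPrime (bigrading K m n) hN hp hx

namespace IsDimensionFiltration

variable {K : Type u} [Field K] {m n : ℕ}
  {M : Type u} [AddCommGroup M] [Module (BiPoly K m n) M] [Module.Finite (BiPoly K m n) M]
  {ℳ : ℤ × ℤ → AddSubgroup M} [DirectSum.Decomposition ℳ]
  [SetLike.GradedSMul (bigrading K m n) ℳ]
  {r : ℕ} {D : Fin (r + 1) → Submodule (BiPoly K m n) M}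

open Submodule

/-- A homogeneous element whose class modulo `D_i` is annihilated by an ideal `p` with
`cd(Q, S/p) ≤ cd(Q, D_i)` lies in `D_i`. -/
lemma mem_of_cohomDim_quotient_le (hD : IsDimensionFiltration ℳ D) (i : Fin (r + 1))
    {b : ℤ × ℤ} {z : M} (hz : z ∈ ℳ b) {p : Ideal (BiPoly K m n)}
    (hpz : p ≤ (D i).colon {z})
    (h : cohomDim (idealQ K m n) (BiPoly K m n ⧸ p) ≤ cohomDim (idealQ K m n) (D i)) :
    z ∈ D i := by
  let := MvPolynomial.weightedDecomposition K (bidegree m n)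
  have hN : (D i ⊔ span (BiPoly K m n) {z}).IsHomogeneous ℳ :=
    (hD.isHomogeneous i).sup (isHomogeneous_span_singleton (bigrading K m n) hz)
  refine hD.le_of_cohomDim_le hN i ?_ (mem_sup_right (mem_span_singleton_self z))
  refine cohomDim_le_of_forall_prime fun q hq hle => ?_
  -- `p` sends D_i + Sz into D_i, which Ann(D_i) then kills.
  have h1 : Module.annihilator (BiPoly K m n) (D i) * p ≤ q := by
    refine le_trans (Ideal.mul_le.2 fun s hs f hf => Module.mem_annihilator.2 ?_) hle
    rintro ⟨x, hx⟩
    obtain ⟨a, ha, c, hc, rfl⟩ := mem_sup.1 hx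
    obtain ⟨g, rfl⟩ := mem_span_singleton.1 hc
    have hs' : ∀ y ∈ D i, s • y = 0 := fun y hy =>
      congrArg Subtype.val (Module.mem_annihilator.1 hs ⟨y, hy⟩)
    refine Subtype.ext ?_
    change (s * f) • (a + g • z) = 0
    rw [mul_smul]
    refine hs' _ ?_
    rw [smul_add, smul_comm f g z]
    exact add_mem (smul_mem _ _ ha) (smul_mem _ _ (mem_colon_singleton.1 (hpz hf)))
  rcases hq.mul_le.1 h1 with h2 | h2
  · exact cohomDim_quotient_le (isZero_localCohomology_idealQ m n) q hq h2
  · refine le_trans ?_ h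
    refine cohomDim_quotient_le (isZero_localCohomology_idealQ m n) q hq ?_
    rwa [Ideal.annihilator_quotient]

lemma associatedPrimes_eq (hD : IsDimensionFiltration ℳ D) (i : Fin (r + 1)) :
    associatedPrimes (BiPoly K m n) (D i) = primesUpTo (D i) := by
  ext p
  constructor
  · intro hp
    refine ⟨associatedPrimes.subset_of_injective (injective_subtype (D i)) hp, ?_⟩
    exact cohomDim_quotient_le (isZero_localCohomology_idealQ m n) p hp.isPrime
      (Submodule.annihilator_top.symm.le.trans (_root_.IsAssociatedPrime.annihilator_le hp))
  · rintro ⟨hp, hcd⟩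
    have hbot : (⊥ : Submodule (BiPoly K m n) M).IsHomogeneous ℳ := by
      rw [← hD.zero_eq_bot]
      exact hD.isHomogeneous 0
    obtain ⟨b, z, hz, hpz⟩ := IsAssociatedPrime.exists_homogeneous (N := ⊥) hp hbot
    have hzD : z ∈ D i := hD.mem_of_cohomDim_quotient_le i hz
      (hpz.le.trans (colon_mono bot_le subset_rfl)) hcd
    refine isAssociatedPrime_iff.2 ⟨hp.isPrime, ⟨z, hzD⟩, ?_⟩
    rw [hpz]
    ext s
    simp only [mem_colon_singleton, mem_bot]
    exact (Subtype.ext_iff (a1 := s • (⟨z, hzD⟩ : D i)) (a2 := 0)).symm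

lemma associatedPrimes_quotient_eq (hD : IsDimensionFiltration ℳ D) (i : Fin (r + 1)) :
    associatedPrimes (BiPoly K m n) (M ⧸ D i) =
      associatedPrimes (BiPoly K m n) M \ primesUpTo (D i) := by
  ext p
  constructor
  · intro hp
    have hp' : (D i).IsAssociatedPrime p := by
      obtain ⟨hp, x, hx⟩ := isAssociatedPrime_iff.1 hp
      obtain ⟨x, rfl⟩ := mkQ_surjective _ x
      refine Submodule.isAssociatedPrime_iff.2 ⟨hp, x, ?_⟩
      rw [hx]
      ext s
      rw [mem_colon_singleton, mem_colon_singleton, mem_bot, ← map_smul, mkQ_apply,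
        Quotient.mk_eq_zero]
    obtain ⟨b, z, hz, hpz⟩ := hp'.exists_homogeneous (hD.isHomogeneous i)
    have hzD : z ∉ D i := by
      intro h
      refine hp.isPrime.ne_top (hpz.trans ((Ideal.eq_top_iff_one _).2 ?_))
      rwa [mem_colon_singleton, one_smul]
    have hcd : ¬ cohomDim (idealQ K m n) (BiPoly K m n ⧸ p) ≤ cohomDim (idealQ K m n) (D i) :=
      fun h => hzD (hD.mem_of_cohomDim_quotient_le i hz hpz.le h)
    refine ⟨?_, fun h => hcd h.2⟩
    -- An element `s` of Ann(D_i) outside `p` turns the witness modulo D_i into one in M: s(fz) = 0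
    -- whenever fz ∈ D_i, and fsz = 0 gives fs ∈ p, hence f ∈ p.
    have hann : ¬ Module.annihilator (BiPoly K m n) (D i) ≤ p := fun h =>
      hcd (cohomDim_quotient_le (isZero_localCohomology_idealQ m n) p hp.isPrime h)
    obtain ⟨s, hs, hsp⟩ := SetLike.not_le_iff_exists.1 hann
    refine isAssociatedPrime_iff.2 ⟨hp.isPrime, s • z, ?_⟩
    ext f
    rw [mem_colon_singleton, mem_bot]
    constructor
    · intro hf
      rw [hpz, mem_colon_singleton] at hf
      rw [smul_comm]
      exact congrArg Subtype.val (Module.mem_annihilator.1 hs ⟨_, hf⟩)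
    · intro hf
      refine (hp.isPrime.mem_or_mem (?_ : f * s ∈ p)).resolve_right hsp
      rw [hpz, mem_colon_singleton, mul_smul, hf]
      exact zero_mem _
  · rintro ⟨hp, hcd⟩
    refine ((associatedPrimes.subset_union_of_exact (injective_subtype (D i))
      (LinearMap.exact_subtype_mkQ (D i))) hp).resolve_left fun h => hcd ?_
    rwa [← hD.associatedPrimes_eq i]

end IsDimensionFiltration

theorem corollary1p6 {K : Type u} [Field K] (m n : ℕ)
    {M : Type u} [AddCommGroup M] [Module (BiPoly K m n) M] [Module.Finite (BiPoly K m n) M]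
    (ℳ : ℤ × ℤ → AddSubgroup M) [DirectSum.Decomposition ℳ]
    [SetLike.GradedSMul (bigrading K m n) ℳ]
    {r : ℕ} (D : Fin (r + 1) → Submodule (BiPoly K m n) M)
    (hD : IsDimensionFiltration ℳ D) :
    ∀ i : Fin r,
      associatedPrimes (BiPoly K m n) (D i.succ) = primesUpTo (D i.succ) ∧
      associatedPrimes (BiPoly K m n) (M ⧸ D i.succ) =
        associatedPrimes (BiPoly K m n) M \ primesUpTo (D i.succ) :=
  fun i => ⟨hD.associatedPrimes_eq i.succ, hD.associatedPrimes_quotient_eq i.succ⟩
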